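/- Let $B_3=\langle \sigma_1,\sigma_2 \mid \sigma_1\sigma_2\sigma_1=\sigma_2\sigma_1\sigma_2\rangle$ be the braid group on three strands. Call an element $a$ of a group $\Gamma$ reversible if there is $g\in\Gamma$ with $gag^{-1}=a^{-1}$ (so the identity is reversible), and write $[a,b]=aba^{-1}b^{-1}$. Then the reversible elements of $B_3$ are exactly the conjugates of the commutators $[\sigma_1\sigma_2\sigma_1,k]$, $k\in B_3$; that is, $x\in B_3$ is reversible if and only if $x=g[\sigma_1\sigma_2\sigma_1,k]g^{-1}$ for some $g,k\in B_3$. -/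

import Mathlib

open scoped commutatorElement

/-- An element `a` of a group is reversible if some `g` in the group satisfies
`g * a * g⁻¹ = a⁻¹`. The identity is reversible in this sense. -/
def IsReversible {G : Type*} [Group G] (a : G) : Prop :=
  ∃ g : G, g * a * g⁻¹ = a⁻¹

/-- The relators of the braid group on three strands: the single braid relation
`s₁ s₂ s₁ = s₂ s₁ s₂`, the two free generators being indexed by `0` and `1`. -/
def braidRelators : Set (FreeGroup (Fin 2)) :=
  {(FreeGroup.of 0 * FreeGroup.of 1 * FreeGroup.of 0) *
    (FreeGroup.of 1 * FreeGroup.of 0 * FreeGroup.of 1)⁻¹}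

/-- The braid group on three strands, given by Artin's presentation
`⟨σ₁, σ₂ | σ₁ σ₂ σ₁ = σ₂ σ₁ σ₂⟩`. -/
abbrev BraidThree : Type := PresentedGroup braidRelators

/-- The first Artin generator. -/
def sigma1 : BraidThree := PresentedGroup.of 0

/-- The second Artin generator. -/
def sigma2 : BraidThree := PresentedGroup.of 1

/-! Write Δ = σ₁σ₂σ₁; Δ² is central, so Δ inverts every [Δ,k]. Conversely let g invert x; then x has
exponent sum 0. Map to SL(2,ℤ). If g has nonzero trace there, Cayley-Hamilton makes the image of x
equal to ±1 (`eq_one_or_neg_one_of_inverted`), so x is a power of Δ², hence trivial. If the trace is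
0, then g is central times a conjugate of Δ (`exists_conj_halfTwist`), so after conjugation Δ
inverts x. Then x⁻¹Δ is a square root of Δ², hence some hΔh⁻¹, and x = [Δ,h]. Both facts read off
from SL(2,ℤ) rest on a cyclic normal form for groups generated by a, b with a² = b³. -/

/-! ### Normal forms in groups generated by a, b with a² = b³ -/

section AmalgamWords

variable {G : Type*} [Group G]

/-- The product of the syllables `a * b` and `a * b⁻¹` coded by a list of booleans. -/
def syllableProd (a b : G) (L : List Bool) : G :=
  (L.map fun s => a * (if s then b else b⁻¹)).prod

/-- `g` is a power of `a ^ 2` times an alternating word in `a` and `b ^ (± 1)`. -/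
def HasAlternatingForm (a b g : G) : Prop :=
  ∃ (n : ℤ) (p : G) (L : List Bool) (q : G), (p = 1 ∨ p = b ∨ p = b⁻¹) ∧ (q = 1 ∨ q = a) ∧
    g = (a ^ 2) ^ n * (p * syllableProd a b L * q)

/-- `g` is conjugate to a power of `a ^ 2` times a cyclically alternating word in `a` and
`b ^ (± 1)`. -/
def HasCyclicForm (a b g : G) : Prop :=
  ∃ (h : G) (n : ℤ) (w : G), g = h * ((a ^ 2) ^ n * w) * h⁻¹ ∧
    (w = 1 ∨ w = a ∨ w = b ∨ w = b⁻¹ ∨ ∃ L : List Bool, L ≠ [] ∧ w = syllableProd a b L)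

theorem syllableProd_nil (a b : G) : syllableProd a b [] = 1 := rfl

theorem syllableProd_cons (a b : G) (s : Bool) (L : List Bool) :
    syllableProd a b (s :: L) = a * (if s then b else b⁻¹) * syllableProd a b L := by
  simp [syllableProd]

theorem syllableProd_append (a b : G) (L M : List Bool) :
    syllableProd a b (L ++ M) = syllableProd a b L * syllableProd a b M := by
  simp [syllableProd]

theorem sq_central {a b : G} (hab : a ^ 2 = b ^ 3) (hgen : Subgroup.closure {a, b} = ⊤) (g : G) :
    Commute (a ^ 2) g := by
  have hg : g ∈ Subgroup.closure {a, b} := hgen ▸ Subgroup.mem_top g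
  induction hg using Subgroup.closure_induction with
  | mem x hx =>
    rcases hx with rfl | rfl
    · exact (Commute.refl x).pow_left 2
    · rw [hab]; exact (Commute.refl _).pow_left 3
  | one => exact Commute.one_right _
  | mul x y _ _ hx hy => exact hx.mul_right hy
  | inv x _ hx => exact hx.inv_right

variable {a b : G}

theorem HasAlternatingForm.sq_zpow_mul {g : G} (hg : HasAlternatingForm a b g) (m : ℤ) :
    HasAlternatingForm a b ((a ^ 2) ^ m * g) := by
  obtain ⟨n, p, L, q, hp, hq, rfl⟩ := hg
  exact ⟨m + n, p, L, q, hp, hq, by simp only [zpow_add, mul_assoc]⟩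

theorem HasAlternatingForm.mul_left_snd (hab : a ^ 2 = b ^ 3) (hc : ∀ g : G, Commute (a ^ 2) g)
    {g : G} (hg : HasAlternatingForm a b g) : HasAlternatingForm a b (b * g) := by
  obtain ⟨n, p, L, q, hp, hq, rfl⟩ := hg
  rw [← mul_assoc, ← ((hc b).zpow_left n).eq, mul_assoc]
  refine HasAlternatingForm.sq_zpow_mul ?_ n
  rcases hp with rfl | rfl | rfl
  · exact ⟨0, b, L, q, by simp, hq, by group⟩
  -- Here b·b = b³b⁻¹ = a²b⁻¹, and the central a² joins the prefix.
  · exact ⟨1, _, L, q, Or.inr (Or.inr rfl), hq, by simp only [hab, pow_succ, pow_zero]; group⟩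
  · exact ⟨0, 1, L, q, by simp, hq, by group⟩

theorem HasAlternatingForm.mul_left_fst (hc : ∀ g : G, Commute (a ^ 2) g)
    {g : G} (hg : HasAlternatingForm a b g) : HasAlternatingForm a b (a * g) := by
  obtain ⟨n, p, L, q, hp, hq, rfl⟩ := hg
  rw [← mul_assoc, ← ((hc a).zpow_left n).eq, mul_assoc]
  refine HasAlternatingForm.sq_zpow_mul ?_ n
  rcases hp with rfl | rfl | rfl
  · rcases L with _ | ⟨s, L⟩
    · rcases hq with rfl | rfl
      · exact ⟨0, 1, [], a, by simp, by simp, by simp [syllableProd_nil]⟩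
      · exact ⟨1, 1, [], 1, by simp, by simp, by simp [syllableProd_nil, pow_two]⟩
    · refine ⟨1, if s then b else b⁻¹, L, q, by cases s <;> simp, hq, ?_⟩
      rw [syllableProd_cons, zpow_one, pow_two]; group
  · exact ⟨0, 1, true :: L, q, by simp, hq, by rw [syllableProd_cons]; simp [mul_assoc]⟩
  · exact ⟨0, 1, false :: L, q, by simp, hq, by rw [syllableProd_cons]; simp [mul_assoc]⟩

theorem hasAlternatingForm (hab : a ^ 2 = b ^ 3) (hgen : Subgroup.closure {a, b} = ⊤) (g : G) :
    HasAlternatingForm a b g := by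
  have hc := sq_central hab hgen
  have hg : g ∈ Subgroup.closure {a, b} := hgen ▸ Subgroup.mem_top g
  induction hg using Subgroup.closure_induction_left with
  | one => exact ⟨0, 1, [], 1, by simp, by simp, by simp [syllableProd_nil]⟩
  | mul_left x hx y _ hy =>
    rcases hx with rfl | rfl
    · exact hy.mul_left_fst hc
    · exact hy.mul_left_snd hab hc
  | inv_mul_cancel x hx y _ hy =>
    rcases hx with rfl | rfl
    · convert (hy.mul_left_fst hc).sq_zpow_mul (-1) using 1
      group
    · convert ((hy.mul_left_snd hab hc).mul_left_snd hab hc).sq_zpow_mul (-1) using 1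
      simp only [hab, pow_succ, pow_zero]; group

theorem HasCyclicForm.conj {g : G} (hg : HasCyclicForm a b g) (k : G) :
    HasCyclicForm a b (k * g * k⁻¹) := by
  obtain ⟨h, n, w, rfl, hw⟩ := hg
  exact ⟨k * h, n, w, by group, hw⟩

theorem HasCyclicForm.of_mul_comm {g h : G} (hg : HasCyclicForm a b (g * h)) :
    HasCyclicForm a b (h * g) := by
  have := hg.conj h
  rwa [← mul_assoc, mul_inv_cancel_right] at this

theorem HasCyclicForm.sq_zpow_mul (hc : ∀ g : G, Commute (a ^ 2) g) {g : G}
    (hg : HasCyclicForm a b g) (m : ℤ) : HasCyclicForm a b ((a ^ 2) ^ m * g) := by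
  obtain ⟨h, n, w, rfl, hw⟩ := hg
  refine ⟨h, m + n, w, ?_, hw⟩
  have := ((hc h).zpow_left m).eq
  simp only [← mul_assoc, this, zpow_add]

theorem hasCyclicForm_word (w : G) (hw : w = 1 ∨ w = a ∨ w = b ∨ w = b⁻¹ ∨
    ∃ L : List Bool, L ≠ [] ∧ w = syllableProd a b L) : HasCyclicForm a b w :=
  ⟨1, 0, w, by simp, hw⟩

/-- The three claims need a joint induction. Cyclically, a trailing a meets the leading a and leaves
a shorter word ending in b or b⁻¹. A trailing b or b⁻¹ either cancels, leaving a shorter word ending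
in a, or flips the last syllable up to a². -/
theorem hasCyclicForm_syllableProd_mul (hab : a ^ 2 = b ^ 3) (hc : ∀ g : G, Commute (a ^ 2) g)
    (m : ℕ) : ∀ L : List Bool, L.length = m → HasCyclicForm a b (syllableProd a b L * a) ∧
      HasCyclicForm a b (syllableProd a b L * b) ∧
      HasCyclicForm a b (syllableProd a b L * b⁻¹) := by
  induction m with
  | zero =>
    intro L hL
    obtain rfl := List.length_eq_zero_iff.mp hL
    simp only [syllableProd_nil, one_mul]
    exact ⟨hasCyclicForm_word _ (by simp), hasCyclicForm_word _ (by simp),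
      hasCyclicForm_word _ (by simp)⟩
  | succ m ih =>
    intro L hL
    constructor
    · obtain ⟨s, M, rfl⟩ := List.exists_cons_of_length_eq_add_one hL
      have hM := ih M (by simpa using hL)
      apply HasCyclicForm.of_mul_comm
      have key : HasCyclicForm a b ((if s then b else b⁻¹) * syllableProd a b M) := by
        apply HasCyclicForm.of_mul_comm
        cases s
        · simpa using hM.2.2
        · simpa using hM.2.1
      convert key.sq_zpow_mul hc 1 using 1
      rw [syllableProd_cons, zpow_one, pow_two]; group
    · obtain ⟨M, s, rfl⟩ : ∃ M s, L = M ++ [s] := by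
        rcases List.eq_nil_or_concat L with h | ⟨M, s, h⟩
        · simp [h] at hL
        · exact ⟨M, s, by simpa using h⟩
      have hM := ih M (by simpa using hL)
      have hne (t : Bool) : HasCyclicForm a b (syllableProd a b (M ++ [t])) :=
        hasCyclicForm_word _ (Or.inr (Or.inr (Or.inr (Or.inr ⟨M ++ [t], by simp, rfl⟩))))
      simp only [syllableProd_append, syllableProd_cons, syllableProd_nil, mul_one] at hne ⊢
      cases s
      · constructor
        · simpa [mul_assoc] using hM.1
        · convert (hne true).sq_zpow_mul hc (-1) using 1
          have h3 : b⁻¹ * b⁻¹ = (a ^ 2) ^ (-1 : ℤ) * b := by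
            simp only [hab, pow_succ, pow_zero]; group
          have := ((hc (syllableProd a b M * a)).zpow_left (-1)).eq
          simp only [Bool.false_eq_true, if_false, if_true, ← mul_assoc] at this ⊢
          rw [this, mul_assoc _ b⁻¹, h3]; group
      · constructor
        · convert (hne false).sq_zpow_mul hc 1 using 1
          have h3 : b * b = (a ^ 2) ^ (1 : ℤ) * b⁻¹ := by
            simp only [hab, pow_succ, pow_zero]; group
          have := ((hc (syllableProd a b M * a)).zpow_left 1).eq
          simp only [Bool.false_eq_true, if_false, if_true, ← mul_assoc] at this ⊢
          rw [this, mul_assoc _ b, h3]; group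
        · simpa [mul_assoc] using hM.1

theorem hasCyclicForm (hab : a ^ 2 = b ^ 3) (hgen : Subgroup.closure {a, b} = ⊤) (g : G) :
    HasCyclicForm a b g := by
  have hc := sq_central hab hgen
  obtain ⟨n, p, L, q, hp, hq, rfl⟩ := hasAlternatingForm hab hgen g
  refine HasCyclicForm.sq_zpow_mul hc ?_ n
  have hL := hasCyclicForm_syllableProd_mul hab hc _ L rfl
  have hne (t : Bool) : HasCyclicForm a b (syllableProd a b (L ++ [t])) :=
    hasCyclicForm_word _ (Or.inr (Or.inr (Or.inr (Or.inr ⟨L ++ [t], by simp, rfl⟩))))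
  simp only [syllableProd_append, syllableProd_cons, syllableProd_nil, mul_one] at hne
  rw [mul_assoc]
  apply HasCyclicForm.of_mul_comm
  rcases hq with rfl | rfl
  · rw [mul_one]
    rcases hp with rfl | rfl | rfl
    · rw [mul_one]
      rcases eq_or_ne L [] with rfl | h
      · exact hasCyclicForm_word _ (Or.inl rfl)
      · exact hasCyclicForm_word _ (Or.inr (Or.inr (Or.inr (Or.inr ⟨L, h, rfl⟩))))
    · exact hL.2.1
    · exact hL.2.2
  · rcases hp with rfl | rfl | rfl
    · simpa using hL.1
    · simpa [mul_assoc] using hne true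
    · simpa [mul_assoc] using hne false

end AmalgamWords

/-! ### Half twist, rotation and exponent sum -/

namespace BraidThree

/-- The half twist. -/
def halfTwist : BraidThree := sigma1 * sigma2 * sigma1

/-- The product of the two generators, a cube root of the full twist. -/
def rotation : BraidThree := sigma1 * sigma2

theorem braid_relation : sigma1 * sigma2 * sigma1 = sigma2 * sigma1 * sigma2 := by
  have h : (PresentedGroup.mk braidRelators) ((FreeGroup.of 0 * FreeGroup.of 1 * FreeGroup.of 0) *
      (FreeGroup.of 1 * FreeGroup.of 0 * FreeGroup.of 1)⁻¹) = 1 :=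
    PresentedGroup.one_of_mem rfl
  rw [map_mul, map_inv, mul_inv_eq_one] at h
  simp only [map_mul] at h
  exact h

theorem halfTwist_sq : halfTwist ^ 2 = rotation ^ 3 := by
  have h := braid_relation
  calc halfTwist ^ 2 = (sigma1 * sigma2 * sigma1) * (sigma1 * sigma2 * sigma1) := pow_two _
    _ = (sigma1 * sigma2 * sigma1) * (sigma2 * sigma1 * sigma2) := by rw [← h]
    _ = rotation ^ 3 := by simp only [rotation, pow_succ, pow_zero, one_mul, mul_assoc]

theorem closure_halfTwist_rotation : Subgroup.closure {halfTwist, rotation} = ⊤ := by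
  have ha : halfTwist ∈ Subgroup.closure {halfTwist, rotation} :=
    Subgroup.subset_closure (by simp)
  have hb : rotation ∈ Subgroup.closure {halfTwist, rotation} :=
    Subgroup.subset_closure (by simp)
  have h1 : sigma1 ∈ Subgroup.closure {halfTwist, rotation} := by
    have : sigma1 = rotation⁻¹ * halfTwist := by simp [rotation, halfTwist, mul_assoc]
    rw [this]
    exact mul_mem (inv_mem hb) ha
  have h2 : sigma2 ∈ Subgroup.closure {halfTwist, rotation} := by
    have : sigma2 = sigma1⁻¹ * rotation := by simp [rotation]
    rw [this]
    exact mul_mem (inv_mem h1) hb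
  rw [eq_top_iff, ← PresentedGroup.closure_range_of braidRelators, Subgroup.closure_le]
  rintro _ ⟨i, rfl⟩
  fin_cases i
  · exact h1
  · exact h2

theorem halfTwist_sq_central (g : BraidThree) : Commute (halfTwist ^ 2) g :=
  sq_central halfTwist_sq closure_halfTwist_rotation g

/-- The exponent sum. -/
def exponentSum : BraidThree →* Multiplicative ℤ :=
  PresentedGroup.toGroup (f := fun _ => Multiplicative.ofAdd 1) <| by
    rintro r rfl
    simp

theorem exponentSum_sigma1 : exponentSum sigma1 = Multiplicative.ofAdd 1 :=
  PresentedGroup.toGroup.of _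

theorem exponentSum_sigma2 : exponentSum sigma2 = Multiplicative.ofAdd 1 :=
  PresentedGroup.toGroup.of _

theorem exponentSum_halfTwist : exponentSum halfTwist = Multiplicative.ofAdd 3 := by
  simp only [halfTwist, map_mul, exponentSum_sigma1, exponentSum_sigma2]
  rfl

/-! ### The image in SL(2,ℤ) -/

open Matrix

/-- The images of the two generators in `SL(2, ℤ)`. -/
def burauGenerator : Fin 2 → SpecialLinearGroup (Fin 2) ℤ :=
  ![⟨!![1, 1; 0, 1], by simp⟩, ⟨!![1, 0; -1, 1], by simp⟩]

/-- The reduced Burau representation at `-1`, with values in `SL(2, ℤ)`. -/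
def burau : BraidThree →* SpecialLinearGroup (Fin 2) ℤ :=
  PresentedGroup.toGroup (f := burauGenerator) <| by
    rintro r rfl
    simp only [map_mul, map_inv, FreeGroup.lift_apply_of, mul_inv_eq_one]
    refine Subtype.ext (?_ : (_ * _ * _ : Matrix (Fin 2) (Fin 2) ℤ) = _ * _ * _)
    simp [burauGenerator]

theorem burau_sigma1 : (burau sigma1 : Matrix (Fin 2) (Fin 2) ℤ) = !![1, 1; 0, 1] :=
  congrArg (fun A : SpecialLinearGroup (Fin 2) ℤ => (A : Matrix (Fin 2) (Fin 2) ℤ))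
    (PresentedGroup.toGroup.of _)

theorem burau_sigma2 : (burau sigma2 : Matrix (Fin 2) (Fin 2) ℤ) = !![1, 0; -1, 1] :=
  congrArg (fun A : SpecialLinearGroup (Fin 2) ℤ => (A : Matrix (Fin 2) (Fin 2) ℤ))
    (PresentedGroup.toGroup.of _)

theorem burau_mul (g h : BraidThree) :
    (burau (g * h) : Matrix (Fin 2) (Fin 2) ℤ) = (burau g : Matrix (Fin 2) (Fin 2) ℤ) * (burau h : Matrix (Fin 2) (Fin 2) ℤ) := by
  simp

theorem burau_rotation : (burau rotation : Matrix (Fin 2) (Fin 2) ℤ) = !![0, 1; -1, 1] := by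
  simp [rotation, burau_sigma1, burau_sigma2]

theorem burau_halfTwist : (burau halfTwist : Matrix (Fin 2) (Fin 2) ℤ) = !![0, 1; -1, 0] := by
  simp [halfTwist, burau_sigma1, burau_sigma2]

theorem burau_rotation_inv :
    (burau rotation⁻¹ : Matrix (Fin 2) (Fin 2) ℤ) = !![1, -1; 1, 0] := by
  rw [map_inv]
  change adjugate (burau rotation : Matrix (Fin 2) (Fin 2) ℤ) = _
  rw [burau_rotation, adjugate_fin_two_of]
  simp

theorem burau_halfTwist_sq : burau (halfTwist ^ 2) = -1 := by
  ext i j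
  rw [pow_two, burau_mul, burau_halfTwist]
  fin_cases i <;> fin_cases j <;> simp

theorem burau_halfTwist_sq_zpow (n : ℤ) :
    burau ((halfTwist ^ 2) ^ n) = 1 ∨ burau ((halfTwist ^ 2) ^ n) = -1 := by
  rw [map_zpow, burau_halfTwist_sq]
  rcases n.even_or_odd with h | h
  · exact Or.inl h.neg_one_zpow
  · exact Or.inr h.neg_one_zpow

/-- Up to sign, syllables are elementary matrices with off-diagonal entry -1; products keep this
sign pattern. So p, t ≥ 1 excludes trace zero, and q + r ≥ 1 excludes scalars. -/
theorem burau_syllableProd {L : List Bool} (hL : L ≠ []) :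
    ∃ s p q r t : ℤ, (s = 1 ∨ s = -1) ∧ 1 ≤ p ∧ 0 ≤ q ∧ 0 ≤ r ∧ 1 ≤ t ∧ 1 ≤ q + r ∧
      (burau (syllableProd halfTwist rotation L) : Matrix (Fin 2) (Fin 2) ℤ) =
        !![s * p, -(s * q); -(s * r), s * t] := by
  induction L with
  | nil => exact absurd rfl hL
  | cons e L ih =>
    rw [syllableProd_cons, burau_mul, burau_mul, burau_halfTwist]
    rcases eq_or_ne L [] with rfl | h
    · cases e
      · refine ⟨1, 1, 0, 1, 1, by simp, by simp, by simp, by simp, by simp, by simp, ?_⟩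
        simp [-map_inv, syllableProd_nil, burau_rotation_inv, one_fin_two]
      · refine ⟨-1, 1, 1, 0, 1, by simp, by simp, by simp, by simp, by simp, by simp, ?_⟩
        simp [syllableProd_nil, burau_rotation, one_fin_two]
    · obtain ⟨s, p, q, r, t, hs, hp, hq, hr, ht, hqr, hM⟩ := ih h
      rw [hM]
      cases e
      · refine ⟨s, p, q, p + r, q + t, hs, hp, hq, by lia, by lia, by lia, ?_⟩
        simp only [Bool.false_eq_true, if_false, burau_rotation_inv]
        ext i j
        fin_cases i <;> fin_cases j <;> simp <;> ring
      · refine ⟨-s, p + r, q + t, r, t, by lia, by lia, by lia, hr, ht, by lia, ?_⟩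
        simp only [if_true, burau_rotation]
        ext i j
        fin_cases i <;> fin_cases j <;> simp <;> ring

/-- A braid whose image in `SL(2, ℤ)` has trace zero is conjugate to the half twist up to a
central factor. -/
theorem exists_conj_halfTwist {g : BraidThree}
    (hg : (burau g : Matrix (Fin 2) (Fin 2) ℤ).trace = 0) :
    ∃ (h : BraidThree) (n : ℤ), g = (halfTwist ^ 2) ^ n * (h * halfTwist * h⁻¹) := by
  obtain ⟨h, n, w, rfl, hw⟩ := hasCyclicForm halfTwist_sq closure_halfTwist_rotation g
  have htr : (burau w : Matrix (Fin 2) (Fin 2) ℤ).trace = 0 := by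
    rw [burau_mul, trace_mul_comm, ← burau_mul, inv_mul_cancel_left, map_mul] at hg
    rcases burau_halfTwist_sq_zpow n with h | h
    · simpa [h] using hg
    · simpa [h] using hg
  rw [trace_fin_two] at htr
  rcases hw with rfl | rfl | rfl | rfl | ⟨L, hL, rfl⟩
  · simp at htr
  · refine ⟨h, n, ?_⟩
    have := ((halfTwist_sq_central h).zpow_left n).eq
    simp only [← mul_assoc, this]
  · simp [burau_rotation] at htr
  · rw [burau_rotation_inv] at htr
    simp at htr
  · obtain ⟨s, p, q, r, t, hs, hp, hq, hr, ht, hqr, hM⟩ := burau_syllableProd hL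
    rw [hM] at htr
    rcases hs with rfl | rfl <;> simp at htr <;> lia

/-- A braid with scalar image in `SL(2, ℤ)` is a power of the full twist. -/
theorem exists_eq_fullTwist_zpow {g : BraidThree} (hg : burau g = 1 ∨ burau g = -1) :
    ∃ n : ℤ, g = (halfTwist ^ 2) ^ n := by
  obtain ⟨h, n, w, rfl, hw⟩ := hasCyclicForm halfTwist_sq closure_halfTwist_rotation g
  have hw1 : burau w = 1 ∨ burau w = -1 := by
    rw [map_mul, map_mul, map_mul, map_inv, mul_inv_eq_iff_eq_mul, mul_inv_eq_iff_eq_mul] at hg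
    rcases burau_halfTwist_sq_zpow n with h | h <;> rw [h] at hg <;>
      simp only [one_mul, neg_mul, mul_neg, mul_eq_left, neg_eq_iff_eq_neg, neg_neg] at hg
    · refine hg.imp_right fun hg => mul_left_cancel (hg.trans ?_)
      simp
    · refine (hg.imp_left fun hg => mul_left_cancel (hg.trans ?_)).symm
      simp
  have hoff : (burau w : Matrix (Fin 2) (Fin 2) ℤ) 0 1 = 0 ∧
      (burau w : Matrix (Fin 2) (Fin 2) ℤ) 1 0 = 0 := by
    rcases hw1 with h | h <;> simp [h]
  rcases hw with rfl | rfl | rfl | rfl | ⟨L, hL, rfl⟩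
  · refine ⟨n, ?_⟩
    have := ((halfTwist_sq_central h).zpow_left n).eq
    rw [mul_one, ← this, mul_inv_cancel_right]
  · simp [burau_halfTwist] at hoff
  · simp [burau_rotation] at hoff
  · rw [burau_rotation_inv] at hoff
    simp at hoff
  · obtain ⟨s, p, q, r, t, hs, hp, hq, hr, ht, hqr, hM⟩ := burau_syllableProd hL
    rw [hM] at hoff
    rcases hs with rfl | rfl <;> simp at hoff <;> lia

/-! ### Inverted elements of SL(2,ℤ) -/

/-- The Cayley-Hamilton identity for two-by-two matrices of determinant one. -/
theorem sq_eq_trace_smul_sub_one {R : Type*} [CommRing R] {A : Matrix (Fin 2) (Fin 2) R}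
    (hd : A.det = 1) : A * A = A.trace • A - 1 := by
  rw [det_fin_two] at hd
  ext i j
  fin_cases i <;> fin_cases j <;>
    simp only [mul_apply, Fin.sum_univ_two, trace_fin_two, Matrix.sub_apply, Matrix.smul_apply, smul_eq_mul,
      Fin.zero_eta, Fin.mk_one, one_apply_eq, one_apply_ne zero_ne_one, one_apply_ne one_ne_zero]
  · linear_combination -hd
  · ring
  · ring
  · linear_combination -hd

theorem eq_one_or_neg_one_of_mul_self {A : Matrix (Fin 2) (Fin 2) ℤ} (hd : A.det = 1)
    (hA : A * A = 1) : A = 1 ∨ A = -1 := by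
  have h := sq_eq_trace_smul_sub_one hd
  rw [hA] at h
  rw [det_fin_two] at hd
  have h00 := congrFun (congrFun h 0) 0
  have h01 := congrFun (congrFun h 0) 1
  have h10 := congrFun (congrFun h 1) 0
  have h11 := congrFun (congrFun h 1) 1
  simp only [trace_fin_two, Matrix.sub_apply, Matrix.smul_apply, smul_eq_mul, one_apply_eq,
    one_apply_ne zero_ne_one, one_apply_ne one_ne_zero, sub_zero] at h00 h01 h10 h11
  -- Cayley-Hamilton now reads tr(A)·A = 2, so A is scalar.
  have ht : A 0 0 + A 1 1 ≠ 0 := by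
    intro h0
    rw [h0] at h00
    simp at h00
  replace h01 := (mul_eq_zero.mp h01.symm).resolve_left ht
  replace h10 := (mul_eq_zero.mp h10.symm).resolve_left ht
  have heq : A 0 0 = A 1 1 := mul_left_cancel₀ ht (by linear_combination h11 - h00)
  rw [h01, heq] at hd
  have h1 : A 1 1 * A 1 1 = 1 := by linear_combination hd
  rcases mul_self_eq_one_iff.mp h1 with h1 | h1
  · left
    ext i j
    fin_cases i <;> fin_cases j <;> simp [h01, h10, heq, h1]
  · right
    ext i j
    fin_cases i <;> fin_cases j <;> simp [h01, h10, heq, h1]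

theorem eq_one_or_neg_one_of_sq {A : SpecialLinearGroup (Fin 2) ℤ} (hA : A * A = 1) :
    A = 1 ∨ A = -1 :=
  (eq_one_or_neg_one_of_mul_self A.det_coe (congrArg Subtype.val hA)).imp Subtype.ext Subtype.ext

/-- In `SL(2, ℤ)`, only a matrix of trace zero inverts an element other than `1` and `-1`. -/
theorem eq_one_or_neg_one_of_inverted {A X : SpecialLinearGroup (Fin 2) ℤ}
    (hA : (A : Matrix (Fin 2) (Fin 2) ℤ).trace ≠ 0) (h : A * X * A⁻¹ = X⁻¹) : X = 1 ∨ X = -1 := by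
  have h1 : A * X = X⁻¹ * A := mul_inv_eq_iff_eq_mul.mp h
  have h2 : A * A * X = X * (A * A) := by
    have h3 : X * A * X = A := by rw [mul_assoc, h1, mul_inv_cancel_left]
    calc A * A * X = A * (A * X) := mul_assoc _ _ _
      _ = (A * X⁻¹) * A := by rw [h1, mul_assoc]
      _ = (X * A * X * X⁻¹) * A := by rw [h3]
      _ = X * (A * A) := by rw [mul_inv_cancel_right, mul_assoc]
  have h4 : (A : Matrix (Fin 2) (Fin 2) ℤ) * (A : Matrix (Fin 2) (Fin 2) ℤ) * (X : Matrix (Fin 2) (Fin 2) ℤ) =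
      (X : Matrix (Fin 2) (Fin 2) ℤ) * ((A : Matrix (Fin 2) (Fin 2) ℤ) * (A : Matrix (Fin 2) (Fin 2) ℤ)) := by
    simpa using congrArg Subtype.val h2
  -- Since A² = tr(A)·A - 1 commutes with X and tr(A) ≠ 0, so does A; hence X = X⁻¹.
  rw [sq_eq_trace_smul_sub_one A.det_coe, sub_mul, mul_sub, one_mul, mul_one, sub_left_inj,
    smul_mul_assoc, mul_smul_comm] at h4
  have h5 : A * X = X * A := Subtype.ext (by simpa using smul_right_injective _ hA h4)
  apply eq_one_or_neg_one_of_sq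
  have h6 : X * A = X⁻¹ * A := h5.symm.trans h1
  have h7 := mul_right_cancel h6
  rw [← mul_inv_cancel X, ← h7]

/-! ### Reversible braids -/

theorem eq_one_of_burau {x : BraidThree} (hx : exponentSum x = 1)
    (h : burau x = 1 ∨ burau x = -1) : x = 1 := by
  obtain ⟨n, rfl⟩ := exists_eq_fullTwist_zpow h
  rw [map_zpow, map_pow, exponentSum_halfTwist] at hx
  have := congrArg Multiplicative.toAdd hx
  simp at this
  simp [this]

theorem exponentSum_eq_one_of_isReversible {x : BraidThree} (hx : IsReversible x) :
    exponentSum x = 1 := by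
  obtain ⟨g, hg⟩ := hx
  have h := congrArg Multiplicative.toAdd (congrArg exponentSum hg)
  simp at h
  exact Multiplicative.toAdd.injective (by simpa using (by lia : (exponentSum x).toAdd = 0))

/-- The half twist is, up to conjugacy, the only square root of the full twist. -/
theorem exists_conj_of_sq_eq {c : BraidThree} (hc : c ^ 2 = halfTwist ^ 2) :
    ∃ h : BraidThree, c = h * halfTwist * h⁻¹ := by
  have htr : (burau c : Matrix (Fin 2) (Fin 2) ℤ).trace = 0 := by
    have h1 : burau c * burau c = -1 := by
      rw [← map_mul, ← pow_two, hc, burau_halfTwist_sq]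
    have h2 : (burau c * burau c : Matrix (Fin 2) (Fin 2) ℤ) = -1 := congrArg Subtype.val h1
    rw [sq_eq_trace_smul_sub_one (burau c).det_coe, sub_eq_neg_self] at h2
    refine (smul_eq_zero.mp h2).resolve_right fun h0 => ?_
    have hd := (burau c).det_coe
    rw [h0] at hd
    simp at hd
  obtain ⟨h, n, rfl⟩ := exists_conj_halfTwist htr
  -- Exponent sums give 2(6n + 3) = 6.
  have he := congrArg Multiplicative.toAdd (congrArg exponentSum hc)
  simp [exponentSum_halfTwist] at he
  obtain rfl : n = 0 := by lia
  exact ⟨h, by simp⟩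

theorem exists_commutator_of_halfTwist_inverts {x : BraidThree}
    (hx : halfTwist * x * halfTwist⁻¹ = x⁻¹) : ∃ k : BraidThree, x = ⁅halfTwist, k⁆ := by
  have hsq : (x⁻¹ * halfTwist) ^ 2 = halfTwist ^ 2 := by
    have h1 := mul_inv_eq_iff_eq_mul.mp hx
    calc _ = x⁻¹ * halfTwist * (halfTwist * x) := by rw [pow_two, h1]
      _ = x⁻¹ * (halfTwist ^ 2 * x) := by simp only [pow_two, mul_assoc]
      _ = halfTwist ^ 2 := by rw [(halfTwist_sq_central x).eq, inv_mul_cancel_left]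
  obtain ⟨h, hh⟩ := exists_conj_of_sq_eq hsq
  refine ⟨h, ?_⟩
  have : x = halfTwist * (x⁻¹ * halfTwist)⁻¹ := by simp
  rw [this, hh, commutatorElement_def]
  group

theorem isReversible_commutator (k g : BraidThree) :
    IsReversible (g * ⁅halfTwist, k⁆ * g⁻¹) := by
  refine ⟨g * halfTwist * g⁻¹, ?_⟩
  have h := (halfTwist_sq_central k).eq
  have key : halfTwist * ⁅halfTwist, k⁆ * halfTwist⁻¹ = ⁅halfTwist, k⁆⁻¹ := by
    rw [commutatorElement_inv, commutatorElement_def, commutatorElement_def]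
    have : halfTwist * (halfTwist * k * halfTwist⁻¹ * k⁻¹) * halfTwist⁻¹ =
      halfTwist ^ 2 * k * halfTwist⁻¹ * k⁻¹ * halfTwist⁻¹ := by
      simp only [pow_two, mul_assoc]
    rw [this, h]
    group
  calc _ = g * (halfTwist * ⁅halfTwist, k⁆ * halfTwist⁻¹) * g⁻¹ := by group
    _ = _ := by rw [key]; group

end BraidThree

open BraidThree in
theorem corollary4p1 (x : BraidThree) :
    IsReversible x ↔
      ∃ k g : BraidThree, x = g * ⁅sigma1 * sigma2 * sigma1, k⁆ * g⁻¹ := by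
  constructor
  · intro hx
    have he := exponentSum_eq_one_of_isReversible hx
    obtain ⟨g, hg⟩ := hx
    by_cases htr : (burau g : Matrix (Fin 2) (Fin 2) ℤ).trace = 0
    · obtain ⟨h, n, rfl⟩ := exists_conj_halfTwist htr
      -- The central factor of the reverser acts trivially by conjugation.
      have hy : halfTwist * (h⁻¹ * x * h) * halfTwist⁻¹ = (h⁻¹ * x * h)⁻¹ := by
        have hz := ((halfTwist_sq_central (h * halfTwist * h⁻¹ * x *
          (h * halfTwist * h⁻¹)⁻¹)).zpow_left n).eq
        have h1 : h * halfTwist * h⁻¹ * x * (h * halfTwist * h⁻¹)⁻¹ = x⁻¹ := by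
          rw [← hg, ← mul_inv_eq_iff_eq_mul.mpr hz]
          group
        calc _ = h⁻¹ * (h * halfTwist * h⁻¹ * x * (h * halfTwist * h⁻¹)⁻¹) * h := by group
          _ = _ := by rw [h1]; group
      obtain ⟨k, hk⟩ := exists_commutator_of_halfTwist_inverts hy
      refine ⟨k, h, ?_⟩
      change x = h * ⁅halfTwist, k⁆ * h⁻¹
      rw [← hk]
      group
    · have hb : burau g * burau x * (burau g)⁻¹ = (burau x)⁻¹ := by
        simp only [← map_mul, ← map_inv, hg]
      obtain rfl := eq_one_of_burau he (eq_one_or_neg_one_of_inverted htr hb)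
      exact ⟨1, 1, by simp⟩
  · rintro ⟨k, g, rfl⟩
    exact isReversible_commutator k g
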